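/- For $i\ge 0$ let $V_i=\frac12\begin{pmatrix}1+\omega&1-\omega\\1-\omega&1+\omega\end{pmatrix}$ with $\omega=e^{\mathrm{i}\pi/2^i}$ be the principal $2^i$-th root of the NOT matrix, so that $V_i^{2^i}=\mathrm{NOT}$; let $R_x(\theta)=e^{-\mathrm{i}\theta X/2}$ with $X=\mathrm{NOT}$, $S=\mathrm{diag}(1,\mathrm{i})$, $T=\mathrm{diag}(1,e^{\mathrm{i}\pi/4})$, and let $H$ be the Hadamard matrix. The elementary gates on $n$ wires are NOT, $S$, $T$, $H$ acting on any one wire, and, for any two distinct wires taken as control and target, CNOT, controlled-$R_x(\theta)$ with $\theta=\pi$ or $\theta=\pm\pi/2^k$ for $1\le k\le n-3$, and controlled-$V_i$ and controlled-$V_i^\dagger$ with $1\le i\le n-2$. An $n$-wire circuit is a finite sequence of elementary gates on its $n$ wires, and its size is the number of gates; it computes $f:\{0,1\}^n\to\{0,1\}^n$ without ancillary bits if its operator maps $|x\rangle$ to $|f(x)\rangle$ for every $x\in\{0,1\}^n$. Theorem. There is a constant $C>0$ such that for every $n\ge 2$, every reversible function (bijection) $f:\{0,1\}^n\to\{0,1\}^n$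 is computed by an $n$-wire circuit with at most $C\cdot 2^n n/\log n$ elementary gates, without ancillary bits. This bound is asymptotically tight: there is a constant $c>0$ such that for every $n\ge 2$ there is a reversible function $f:\{0,1\}^n\to\{0,1\}^n$ such that every $n$-wire circuit computing $f$ has at least $c\cdot 2^n n/\log n$ elementary gates. -/

import Mathlib

noncomputable section

namespace RevCircuit

/-- The `n`-bit strings `{0,1}ⁿ`. They index the computational basis of `(ℂ²)^{⊗ n}`. -/
abbrev Bits (n : ℕ) : Type := Fin n → Fin 2

/-- Operators on `n` qubits, as matrices in the computational basis. -/
abbrev Op (n : ℕ) : Type := Matrix (Bits n) (Bits n) ℂ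

/-- The basis vector `|x⟩`. -/
def ket {n : ℕ} (x : Bits n) : Bits n → ℂ := Pi.single x 1

/-- The Pauli matrix `X`, that is, the NOT gate. -/
def matX : Matrix (Fin 2) (Fin 2) ℂ := !![0, 1; 1, 0]

/-- The phase gate `S = diag(1, i)`. -/
def matS : Matrix (Fin 2) (Fin 2) ℂ := !![1, 0; 0, Complex.I]

/-- The gate `T = diag(1, exp(iπ/4))`. -/
def matT : Matrix (Fin 2) (Fin 2) ℂ :=
  !![1, 0; 0, Complex.exp (Complex.I * Real.pi / 4)]

/-- The Hadamard gate. -/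
def matH : Matrix (Fin 2) (Fin 2) ℂ :=
  (((Real.sqrt 2)⁻¹ : ℝ) : ℂ) • !![1, 1; 1, -1]

/-- The rotation `R_x(θ) = exp(-iθX/2)`. -/
def matRx (θ : ℝ) : Matrix (Fin 2) (Fin 2) ℂ :=
  !![(Real.cos (θ / 2) : ℂ), -Complex.I * (Real.sin (θ / 2) : ℂ);
     -Complex.I * (Real.sin (θ / 2) : ℂ), (Real.cos (θ / 2) : ℂ)]

/-- The principal `2^i`-th root `V_i` of NOT: eigenvalue `1` on `(1, 1)` and eigenvalue
`exp(iπ/2^i)` on `(1, -1)`. -/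
def matV (i : ℕ) : Matrix (Fin 2) (Fin 2) ℂ :=
  !![(1 + Complex.exp (Complex.I * Real.pi / 2 ^ i)) / 2,
     (1 - Complex.exp (Complex.I * Real.pi / 2 ^ i)) / 2;
     (1 - Complex.exp (Complex.I * Real.pi / 2 ^ i)) / 2,
     (1 + Complex.exp (Complex.I * Real.pi / 2 ^ i)) / 2]

theorem matV_zero : matV 0 = matX := by
  have h : Complex.exp (Complex.I * Real.pi / 2 ^ 0) = -1 := by
    rw [pow_zero, div_one, mul_comm, Complex.exp_pi_mul_I]
  simp only [matV, matX, h]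
  norm_num

theorem matV_succ_mul_self (i : ℕ) : matV (i + 1) * matV (i + 1) = matV i := by
  have h : Complex.exp (Complex.I * Real.pi / 2 ^ i) =
      Complex.exp (Complex.I * Real.pi / 2 ^ (i + 1)) *
        Complex.exp (Complex.I * Real.pi / 2 ^ (i + 1)) := by
    rw [← Complex.exp_add]
    congr 1
    field_simp
    ring
  simp only [matV, h, Matrix.mul_fin_two]
  congr 1
  ring_nf

/-- The defining property `V_i ^ (2^i) = NOT`. -/
theorem matV_pow (i : ℕ) : matV i ^ (2 ^ i) = matX := by
  induction i with
  | zero => simp [matV_zero]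
  | succ i ih => rw [pow_succ', pow_mul, sq, matV_succ_mul_self, ih]

/-- The one-qubit operator `U` acting on wire `t` of an `n`-wire circuit: the tensor product of
`U` at position `t` with the identity at all other positions. -/
def onWire {n : ℕ} (U : Matrix (Fin 2) (Fin 2) ℂ) (t : Fin n) : Op n :=
  Matrix.of fun y x => if ∀ j, j ≠ t → y j = x j then U (y t) (x t) else 0

/-- The controlled operator: `U` is applied to wire `t` if the bit on wire `c` is `1`, and nothing
happens if it is `0`. Used for `c ≠ t` only. -/
def ctrl {n : ℕ} (U : Matrix (Fin 2) (Fin 2) ℂ) (c t : Fin n) : Op n :=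
  Matrix.of fun y x => if x c = 1 then onWire U t y x else (1 : Op n) y x

/-- The rotation angles `π, ±π/2, ±π/4, …, ±π/2^(n-3)` allowed on `n` wires. -/
def angles (n : ℕ) : Set ℝ :=
  {θ | θ = Real.pi ∨
    ∃ k : ℕ, 1 ≤ k ∧ k + 3 ≤ n ∧ (θ = Real.pi / 2 ^ k ∨ θ = -(Real.pi / 2 ^ k))}

/-- The elementary gates on `n` wires, together with the wires they act on. In the two-qubit gates
`c` is the control wire and `t` the target wire. -/
inductive Gate (n : ℕ) : Type
  | gateNot (t : Fin n) : Gate n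
  | gateS (t : Fin n) : Gate n
  | gateT (t : Fin n) : Gate n
  | gateH (t : Fin n) : Gate n
  | cnot (c t : Fin n) (hct : c ≠ t) : Gate n
  | crx (θ : ℝ) (hθ : θ ∈ angles n) (c t : Fin n) (hct : c ≠ t) : Gate n
  | cv (i : ℕ) (hi : 1 ≤ i ∧ i + 2 ≤ n) (c t : Fin n) (hct : c ≠ t) : Gate n
  | cvDagger (i : ℕ) (hi : 1 ≤ i ∧ i + 2 ≤ n) (c t : Fin n) (hct : c ≠ t) : Gate n

/-- The operator of an elementary gate. -/
def Gate.op {n : ℕ} : Gate n → Op n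
  | .gateNot t => onWire matX t
  | .gateS t => onWire matS t
  | .gateT t => onWire matT t
  | .gateH t => onWire matH t
  | .cnot c t _ => ctrl matX c t
  | .crx θ _ c t _ => ctrl (matRx θ) c t
  | .cv i _ c t _ => ctrl (matV i) c t
  | .cvDagger i _ c t _ => ctrl (matV i).conjTranspose c t

/-- A circuit on exactly `n` wires is a finite sequence of elementary gates on these wires, applied
from left to right. Its size is the length of the list. -/
abbrev Circuit (n : ℕ) : Type := List (Gate n)

/-- The operator of a circuit; the first gate of the list acts first. -/
def circuitOp {n : ℕ} : Circuit n → Op n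
  | [] => 1
  | g :: K => circuitOp K * g.op

/-- The circuit maps `|x⟩` to `|f x⟩` (exactly, with no phase) for every `x`. As it has only the
`n` wires of the input, it uses no ancillary bits. -/
def Computes {n : ℕ} (K : Circuit n) (f : Bits n → Bits n) : Prop :=
  ∀ x : Bits n, (circuitOp K).mulVec (ket x) = ket (f x)

end RevCircuit

end

namespace RevCircuit
open Finset
open scoped Fin.CommRing
variable {n : ℕ}

/-! Upper bound. A permutation is reduced to the identity by exchanging many pairs at once. If `T`
has `2 ^ (q - 1)` points and is disjoint from its image under `f`, exchanging each `x` in `T` with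
`f x` makes the product fix `T` and moves no new point. The `2 ^ q` strings involved are first
brought to a canonical form: an address on `q` wires and ones on all others
(`exists_canonical_form`). There one multiply controlled NOT does all exchanges, and the preparation
is undone (`exists_hasCost_exchange`).

With `2 ^ q` of order `log n`, the preparation takes `O(n)` gates: there are at most `2 ^ 2 ^ q`
distinct columns in the table of strings, each computed once and copied. The NOT takes `O(n)` gates
because an address wire can be borrowed (`hasCost_addAt_conj_linear`). So `O(2 ^ n / log n)` groups
of `O(n)` gates suffice, and the few points left over are handled by transpositions. A transposition
may be odd, so it needs a NOT controlled by all other wires with no wire to borrow; roots of NOT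
provide it (`hasCost_addAt_conj`). Only NOT, CNOT and controlled `V_i`, `V_i†` are used.

Lower bound. There are `O(n ^ 3)` gate operators, so short circuits are too few for the `(2 ^ n)!`
permutations. -/

/-! ### Bit arithmetic and the cost of a permutation -/

theorem fin_two_add_self (a : Fin 2) : a + a = 0 := by revert a; decide

theorem bits_add_self (x : Bits n) : x + x = 0 := by
  funext i; exact fin_two_add_self (x i)

theorem bits_add_add_self (x y : Bits n) : x + y + y = x := by
  rw [add_assoc, bits_add_self, add_zero]

/-- Add the bit `P x` to wire `t`. -/
def addAt (t : Fin n) (P : Bits n → Fin 2) (x : Bits n) : Bits n := x + Pi.single t (P x)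

theorem addAt_apply_self (t : Fin n) (P : Bits n → Fin 2) (x : Bits n) :
    addAt t P x t = x t + P x := by simp [addAt]

theorem addAt_apply_of_ne {t w : Fin n} (h : w ≠ t) (P : Bits n → Fin 2) (x : Bits n) :
    addAt t P x w = x w := by simp [addAt, h]

/-- The conjunction of the bits on the wires in `A`. -/
def conj (A : Finset (Fin n)) (x : Bits n) : Fin 2 := ∏ c ∈ A, x c

theorem conj_congr {A : Finset (Fin n)} {x y : Bits n} (h : ∀ c ∈ A, x c = y c) :
    conj A x = conj A y := Finset.prod_congr rfl h

/-- `P` depends only on the wires in `D`. -/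
def DependsOn (P : Bits n → Fin 2) (D : Finset (Fin n)) : Prop :=
  ∀ x y, (∀ d ∈ D, x d = y d) → P x = P y

theorem dependsOn_conj (A : Finset (Fin n)) : DependsOn (conj A) A := fun _ _ => conj_congr

theorem DependsOn.apply_add_single {P : Bits n → Fin 2} {D : Finset (Fin n)} (h : DependsOn P D)
    {t : Fin n} (ht : t ∉ D) (x : Bits n) (b : Fin 2) : P (x + Pi.single t b) = P x :=
  h _ _ fun d hd => by
    have : d ≠ t := fun e => ht (e ▸ hd)
    simp [this]

theorem addAt_involutive {P : Bits n → Fin 2} {D : Finset (Fin n)} (h : DependsOn P D)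
    {t : Fin n} (ht : t ∉ D) : Function.Involutive (addAt t P) := fun x => by
  rw [addAt, addAt, h.apply_add_single ht, bits_add_add_self]

theorem circuitOp_append (K L : Circuit n) : circuitOp (K ++ L) = circuitOp L * circuitOp K := by
  induction K with
  | nil => simp [circuitOp]
  | cons g K ih => simp [circuitOp, ih, Matrix.mul_assoc]

/-- `f` is a bijection, and circuits with at most `s` gates compute `f` and its inverse. -/
def HasCost (s : ℕ) (f : Bits n → Bits n) : Prop :=
  ∃ (g : Bits n → Bits n) (K L : Circuit n), Function.LeftInverse g f ∧
    Function.RightInverse g f ∧ Computes K f ∧ Computes L g ∧ K.length ≤ s ∧ L.length ≤ s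

theorem Computes.comp {K L : Circuit n} {f g : Bits n → Bits n} (hf : Computes K f)
    (hg : Computes L g) : Computes (K ++ L) (g ∘ f) := fun x => by
  rw [circuitOp_append, ← Matrix.mulVec_mulVec, hf, hg]; rfl

theorem HasCost.comp {s r : ℕ} {f g : Bits n → Bits n} (hg : HasCost r g) (hf : HasCost s f) :
    HasCost (s + r) (g ∘ f) := by
  obtain ⟨f', K, L, h1, h2, h3, h4, h5, h6⟩ := hf
  obtain ⟨g', K', L', k1, k2, k3, k4, k5, k6⟩ := hg
  refine ⟨f' ∘ g', K ++ K', L' ++ L, k1.comp h1, k2.comp h2, h3.comp k3, k4.comp h4, ?_, ?_⟩ <;>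
    simp <;> omega

theorem HasCost.mono {s r : ℕ} {f : Bits n → Bits n} (hf : HasCost s f) (h : s ≤ r) :
    HasCost r f := by
  obtain ⟨f', K, L, h1, h2, h3, h4, h5, h6⟩ := hf
  exact ⟨f', K, L, h1, h2, h3, h4, h5.trans h, h6.trans h⟩

/-- Conjugations need circuits for inverses. `HasCost` carries both circuits because a circuit
cannot be inverted gate by gate: `S` and `T` have no inverse in the gate list. -/
theorem HasCost.inv {s : ℕ} {f g : Bits n → Bits n} (hf : HasCost s f)
    (h : Function.LeftInverse g f) : HasCost s g := by
  obtain ⟨f', K, L, h1, h2, h3, h4, h5, h6⟩ := hf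
  have : g = f' := by
    funext x
    rw [← h2 x, h, h1]
  subst this
  exact ⟨f, L, K, h2, h1, h4, h3, h6, h5⟩

theorem HasCost.bijective {s : ℕ} {f : Bits n → Bits n} (hf : HasCost s f) :
    Function.Bijective f := by
  obtain ⟨f', K, L, h1, h2, -⟩ := hf
  exact ⟨h1.injective, h2.surjective⟩

theorem HasCost.of_involutive {s : ℕ} {f : Bits n → Bits n} {K : Circuit n}
    (h : Function.Involutive f) (hK : Computes K f) (hs : K.length ≤ s) : HasCost s f :=
  ⟨f, K, K, h, h, hK, hK, hs, hs⟩

theorem hasCost_id : HasCost 0 (id : Bits n → Bits n) :=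
  .of_involutive (K := []) (fun _ => rfl) (fun x => by simp [circuitOp]) le_rfl

/-! ### Action of the gates on basis states -/

/-- The matrix with eigenvalue `1` on `(1, 1)` and `z` on `(1, -1)`. -/
noncomputable def rootX (z : ℂ) : Matrix (Fin 2) (Fin 2) ℂ :=
  !![(1 + z) / 2, (1 - z) / 2; (1 - z) / 2, (1 + z) / 2]

theorem onWire_rootX_mulVec_ket (z : ℂ) (t : Fin n) (x : Bits n) :
    (onWire (rootX z) t).mulVec (ket x) =
      ((1 + z) / 2) • ket x + ((1 - z) / 2) • ket (x + Pi.single t 1) := by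
  funext y
  rw [ket, Matrix.mulVec_single_one]
  have key : (∀ j, j ≠ t → y j = x j) ↔ y = x ∨ y = x + Pi.single t 1 := by
    constructor
    · intro h
      have h2 : y t = x t ∨ y t = x t + 1 := by
        generalize y t = a; generalize x t = b; revert a b; decide
      refine h2.imp (fun h2 => ?_) (fun h2 => ?_) <;> funext j <;> by_cases hj : j = t
      · subst hj; exact h2
      · exact h j hj
      · subst hj; simpa using h2
      · simpa [hj] using h j hj
    · rintro (rfl | rfl) j hj <;> simp [hj]
  have hne : x ≠ x + Pi.single t 1 := fun h => by
    have := congrFun h t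
    simp at this
  have h01 : ∀ a : Fin 2, rootX z a a = (1 + z) / 2 ∧ rootX z (a + 1) a = (1 - z) / 2 := by
    intro a; fin_cases a <;> simp [rootX]
  simp only [Matrix.col_apply, onWire, Matrix.of_apply, key, Pi.add_apply, Pi.smul_apply, ket]
  by_cases h1 : y = x
  · subst h1; simp [h01, hne]
  · by_cases h2 : y = x + Pi.single t 1
    · subst h2; simp [h01, hne.symm]
    · simp [h1, h2]

theorem ctrl_mulVec_ket (U : Matrix (Fin 2) (Fin 2) ℂ) (c t : Fin n) (x : Bits n) :
    (ctrl U c t).mulVec (ket x) = if x c = 1 then (onWire U t).mulVec (ket x) else ket x := by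
  funext y
  simp only [ket, Matrix.mulVec_single_one, Matrix.col_apply, ctrl, Matrix.of_apply]
  split_ifs
  · simp
  · simp [Matrix.one_apply, Pi.single_apply]

theorem matX_eq_rootX : matX = rootX (-1) := by simp [matX, rootX]

theorem matV_eq_rootX (i : ℕ) :
    matV i = rootX (Complex.exp (Complex.I * Real.pi / 2 ^ i)) := rfl

theorem conjTranspose_matV (i : ℕ) :
    (matV i).conjTranspose = rootX (Complex.exp (Complex.I * Real.pi / 2 ^ i))⁻¹ := by
  have h : (starRingEnd ℂ) (Complex.exp (Complex.I * Real.pi / 2 ^ i)) =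
      (Complex.exp (Complex.I * Real.pi / 2 ^ i))⁻¹ := by
    rw [← Complex.exp_conj, ← Complex.exp_neg]
    congr 1
    have : (starRingEnd ℂ) 2 = 2 := Complex.conj_ofNat 2
    simp [neg_div, this]
  rw [matV_eq_rootX]
  ext a b
  fin_cases a <;> fin_cases b <;> simp [rootX, h]

theorem onWire_matX_mulVec_ket (t : Fin n) (x : Bits n) :
    (onWire matX t).mulVec (ket x) = ket (x + Pi.single t 1) := by
  rw [matX_eq_rootX, onWire_rootX_mulVec_ket]; norm_num

theorem computes_not (t : Fin n) : Computes [.gateNot t] (addAt t fun _ => 1) := fun x => by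
  simp [circuitOp, Gate.op, addAt, onWire_matX_mulVec_ket]

theorem computes_cnot {c t : Fin n} (h : c ≠ t) :
    Computes [.cnot c t h] (addAt t fun x => x c) := fun x => by
  simp only [circuitOp, Gate.op, one_mul, ctrl_mulVec_ket, onWire_matX_mulVec_ket, addAt]
  split_ifs with h
  · rw [h]
  · have : x c = 0 := by omega
    simp [this]

theorem dependsOn_apply (c : Fin n) : DependsOn (fun x : Bits n => x c) {c} :=
  fun _ _ h => h c (by simp)

theorem dependsOn_const (b : Fin 2) : DependsOn (fun _ : Bits n => b) ∅ := fun _ _ _ => rfl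

theorem hasCost_not (t : Fin n) : HasCost 1 (addAt t fun _ => 1) :=
  .of_involutive (addAt_involutive (dependsOn_const 1) (by simp)) (computes_not t) le_rfl

theorem hasCost_cnot {c t : Fin n} (h : c ≠ t) : HasCost 1 (addAt t fun x => x c) :=
  .of_involutive (addAt_involutive (dependsOn_apply c) (by simpa using h.symm))
    (computes_cnot h) le_rfl

/-! ### Multiply controlled NOT without a spare wire -/

/-- On a basis state `x`, the circuit applies `rootX (z ^ F x)` to wire `t`. -/
def AppliesRoot (K : Circuit n) (t : Fin n) (z : ℂ) (F : Bits n → ℤ) : Prop :=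
  ∀ x, (circuitOp K).mulVec (ket x) =
    ((1 + z ^ F x) / 2) • ket x + ((1 - z ^ F x) / 2) • ket (x + Pi.single t 1)

/-- After `K`, wire `t` may be in superposition, so exponents add only if `G` does not see wire `t`.
-/
theorem AppliesRoot.append {K L : Circuit n} {t : Fin n} {z : ℂ} (hz : z ≠ 0) {F G : Bits n → ℤ}
    (hK : AppliesRoot K t z F) (hL : AppliesRoot L t z G)
    (hG : ∀ x, G (x + Pi.single t 1) = G x) :
    AppliesRoot (K ++ L) t z fun x => F x + G x := fun x => by
  rw [circuitOp_append, ← Matrix.mulVec_mulVec, hK, Matrix.mulVec_add, Matrix.mulVec_smul,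
    Matrix.mulVec_smul, hL, hL, hG, bits_add_add_self, zpow_add₀ hz]
  module

theorem AppliesRoot.conj_cnot {K : Circuit n} {t : Fin n} {z : ℂ} {F : Bits n → ℤ}
    (hK : AppliesRoot K t z F) {c w : Fin n} (hcw : c ≠ w) (hct : c ≠ t) :
    AppliesRoot ([.cnot c w hcw] ++ K ++ [.cnot c w hcw]) t z
      fun x => F (addAt w (fun x => x c) x) := fun x => by
  have hi := addAt_involutive (dependsOn_apply c) (t := w) (by simpa using hcw.symm)
  rw [circuitOp_append, circuitOp_append, ← Matrix.mulVec_mulVec, ← Matrix.mulVec_mulVec,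
    computes_cnot hcw x, hK, Matrix.mulVec_add, Matrix.mulVec_smul, Matrix.mulVec_smul,
    computes_cnot hcw, computes_cnot hcw, hi x]
  congr 3
  simp only [addAt, Pi.add_apply, Pi.single_eq_of_ne hcw, Pi.single_eq_of_ne hct, add_zero]
  rw [add_right_comm x, bits_add_add_self]

/-- A bit as an integer. -/
def bitInt (a : Fin 2) : ℤ := (a : ℕ)

theorem bitInt_mul (a b : Fin 2) : bitInt (a * b) = bitInt a * bitInt b := by
  revert a b; decide

theorem bitInt_add (a b : Fin 2) :
    bitInt (a + b) = bitInt a + bitInt b - 2 * bitInt a * bitInt b := by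
  revert a b; decide

/-- Each new control `c` subtracts from the exponent its value with `x m` toggled by `x c`. As
integers, `m - (m ⊕ c) = c (2m - 1)`, and toggling `m` negates `2m - 1`, so every later control
contributes a factor `2c`. -/
theorem exists_appliesRoot_parity {i : ℕ} (hi : 1 ≤ i ∧ i + 2 ≤ n) {m t : Fin n} (hmt : m ≠ t)
    (A : Finset (Fin n)) (hm : m ∉ A) (ht : t ∉ A) (ε : ℤ) (hε : ε = 1 ∨ ε = -1) :
    ∃ K : Circuit n, K.length + 2 ≤ 3 * 2 ^ #A ∧
      AppliesRoot K t (Complex.exp (Complex.I * Real.pi / 2 ^ i)) fun x =>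
        ε * if A = ∅ then bitInt (x m)
          else 2 ^ (#A - 1) * bitInt (conj A x) * (2 * bitInt (x m) - 1) := by
  induction A using Finset.induction_on generalizing ε with
  | empty =>
    rcases hε with rfl | rfl
    · refine ⟨[.cv i hi m t hmt], by simp, fun x => ?_⟩
      simp only [circuitOp, Gate.op, one_mul, ctrl_mulVec_ket, matV_eq_rootX,
        onWire_rootX_mulVec_ket, if_true]
      split_ifs with h
      · simp [h, bitInt]
      · have : x m = 0 := by omega
        simp [this, bitInt]
    · refine ⟨[.cvDagger i hi m t hmt], by simp, fun x => ?_⟩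
      simp only [circuitOp, Gate.op, one_mul, ctrl_mulVec_ket, conjTranspose_matV,
        onWire_rootX_mulVec_ket, if_true]
      split_ifs with h
      · simp [h, bitInt]
      · have : x m = 0 := by omega
        simp [this, bitInt]
  | insert c A hc ih =>
    simp only [mem_insert, not_or] at hm ht
    obtain ⟨K, hKl, hK⟩ := ih hm.2 ht.2 ε hε
    obtain ⟨L, hLl, hL⟩ := ih hm.2 ht.2 (-ε) (by omega)
    have hcm : c ≠ m := Ne.symm hm.1
    refine ⟨K ++ ([.cnot c m hcm] ++ L ++ [.cnot c m hcm]), ?_, ?_⟩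
    · rw [card_insert_of_notMem hc, pow_succ]; simp; omega
    · have := hK.append (Complex.exp_ne_zero _) (hL.conj_cnot hcm (Ne.symm ht.1)) ?_
      · convert this using 2 with x
        have e1 : addAt m (fun x => x c) x m = x m + x c := addAt_apply_self ..
        have e2 : conj A (addAt m (fun x => x c) x) = conj A x :=
          conj_congr fun d hd => addAt_apply_of_ne (ne_of_mem_of_not_mem hd hm.2) ..
        have e3 : conj (insert c A) x = x c * conj A x := prod_insert hc
        rw [e1, e2, e3, bitInt_mul, bitInt_add, if_neg (insert_ne_empty c A),
          card_insert_of_notMem hc, Nat.add_sub_cancel]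
        rcases A.eq_empty_or_nonempty with rfl | hA
        · have : bitInt (conj ∅ x) = 1 := by simp [conj, bitInt]
          simp only [if_true, this, card_empty]
          ring
        · obtain ⟨k, hk⟩ := Nat.exists_eq_succ_of_ne_zero hA.card_pos.ne'
          rw [if_neg hA.ne_empty, if_neg hA.ne_empty, hk, Nat.succ_sub_one, pow_succ]
          ring
      · intro x
        have e0 : ∀ d, d ≠ t → addAt m (fun x => x c) (x + Pi.single t 1) d =
            addAt m (fun x => x c) x d := by
          intro d hd
          by_cases hdm : d = m
          · subst hdm; simp [addAt_apply_self, hd, Ne.symm ht.1]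
          · simp [addAt_apply_of_ne hdm, hd]
        rw [e0 m hmt, conj_congr fun d hd => e0 d fun e => ht.2 (e ▸ hd)]

/-- With `y = 2 ^ (#A - 1) * conj A`, the parity circuit gives `y (2m - 1)`, and adding the exponent
`y` from the induction turns this into `2my`. -/
theorem exists_appliesRoot_conj {i : ℕ} (hi : 1 ≤ i ∧ i + 2 ≤ n) {t : Fin n}
    (A : Finset (Fin n)) (ht : t ∉ A) :
    ∃ K : Circuit n, K.length ≤ 3 * 2 ^ #A ∧
      AppliesRoot K t (Complex.exp (Complex.I * Real.pi / 2 ^ i)) fun x =>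
        if A = ∅ then 0 else 2 ^ (#A - 1) * bitInt (conj A x) := by
  induction A using Finset.induction_on with
  | empty => exact ⟨[], by simp, fun x => by simp [circuitOp]⟩
  | insert m A hm ih =>
    simp only [mem_insert, not_or] at ht
    obtain ⟨K, hKl, hK⟩ := exists_appliesRoot_parity hi (Ne.symm ht.1) A hm ht.2 1 (.inl rfl)
    obtain ⟨L, hLl, hL⟩ := ih ht.2
    refine ⟨K ++ L, ?_, ?_⟩
    · rw [card_insert_of_notMem hm, pow_succ]; simp; omega
    · have := hK.append (Complex.exp_ne_zero _) hL ?_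
      · convert this using 2 with x
        have e3 : conj (insert m A) x = x m * conj A x := prod_insert hm
        rw [e3, bitInt_mul, if_neg (insert_ne_empty m A),
          card_insert_of_notMem hm, Nat.add_sub_cancel]
        rcases A.eq_empty_or_nonempty with rfl | hA
        · have : bitInt (conj ∅ x) = 1 := by simp [conj, bitInt]
          simp [this]
        · obtain ⟨k, hk⟩ := Nat.exists_eq_succ_of_ne_zero hA.card_pos.ne'
          rw [if_neg hA.ne_empty, if_neg hA.ne_empty, hk, Nat.succ_sub_one, pow_succ]
          ring
      · intro x
        rw [(dependsOn_conj A).apply_add_single ht.2]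

theorem hasCost_addAt_conj {t : Fin n} (A : Finset (Fin n)) (ht : t ∉ A) :
    HasCost (3 * 2 ^ #A) (addAt t (conj A)) := by
  rcases A.eq_empty_or_nonempty with rfl | hA
  · exact (hasCost_not t).mono (by simp)
  -- A single control would call for controlled `V_0`, which is not a listed gate; CNOT replaces it.
  by_cases h1 : #A = 1
  · obtain ⟨c, rfl⟩ := card_eq_one.1 h1
    have : conj {c} = fun x : Bits n => x c := by funext x; simp [conj]
    rw [this]
    exact (hasCost_cnot (by simpa [eq_comm] using ht)).mono (by simp)
  have hc := hA.card_pos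
  have hn : #A + 1 ≤ n := by
    simpa [card_insert_of_notMem ht] using card_le_univ (insert t A)
  -- The index `#A - 1` is at most `n - 2`, so the root is available even when `A` is every wire but
  -- `t`; its `2 ^ (#A - 1)`-th power is NOT.
  obtain ⟨K, hKl, hK⟩ := exists_appliesRoot_conj (i := #A - 1) (by omega) A ht
  refine .of_involutive (addAt_involutive (dependsOn_conj A) ht) (K := K) (fun x => ?_) hKl
  rw [hK x, addAt]
  simp only [if_neg hA.ne_empty]
  have h2 : conj A x = 0 ∨ conj A x = 1 := by omega
  rcases h2 with h | h
  · simp [h, bitInt]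
  · have : Complex.exp (Complex.I * Real.pi / 2 ^ (#A - 1)) ^ ((2 : ℤ) ^ (#A - 1)) = -1 := by
      have e : ((2 : ℤ) ^ (#A - 1)) = ((2 ^ (#A - 1) : ℕ) : ℤ) := by simp
      rw [e, zpow_natCast, ← Complex.exp_nat_mul, ← Complex.exp_pi_mul_I]
      congr 1
      push_cast
      field_simp
    simp [h, bitInt, this]


/-! ### Adding Boolean functions of few wires -/

theorem hasCost_add_sum {ι : Type*} [DecidableEq ι] (S : Finset ι) (δ : ι → Bits n → Bits n)
    (s : ι → ℕ) (h : ∀ i ∈ S, HasCost (s i) fun x => x + δ i x)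
    (hδ : ∀ i ∈ S, ∀ j ∈ S, i ≠ j → ∀ x, δ j (x + δ i x) = δ j x) :
    HasCost (∑ i ∈ S, s i) fun x => x + ∑ i ∈ S, δ i x := by
  induction S using Finset.induction_on with
  | empty => simp only [sum_empty, add_zero]; exact hasCost_id
  | insert i S hi ih =>
    have h1 := ih (fun j hj => h j (mem_insert_of_mem hj)) fun j hj k hk =>
      hδ j (mem_insert_of_mem hj) k (mem_insert_of_mem hk)
    rw [sum_insert hi]
    convert h1.comp (h i (mem_insert_self i S)) using 1
    funext x
    rw [sum_insert hi, Function.comp_apply, ← add_assoc]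
    congr 1
    refine sum_congr rfl fun j hj => (hδ i (mem_insert_self i S) j (mem_insert_of_mem hj) ?_ x).symm
    exact (ne_of_mem_of_not_mem hj hi).symm

theorem hasCost_add_const (v : Bits n) : HasCost n fun x => x + v := by
  convert hasCost_add_sum univ (fun t _ => Pi.single t (v t)) (fun _ => 1) ?_ ?_ using 1
  · simp
  · funext x; rw [Finset.univ_sum_single]
  · intro t _
    have h2 : v t = 0 ∨ v t = 1 := by omega
    rcases h2 with h | h
    · simp only [h, Pi.single_zero, add_zero]; exact hasCost_id.mono (Nat.zero_le 1)
    · rw [h]; exact hasCost_not t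
  · simp

/-- The string with `b` on the wires in `S` and `0` elsewhere. -/
def constOn (S : Finset (Fin n)) (b : Fin 2) : Bits n := fun w => if w ∈ S then b else 0

theorem constOn_eq_sum (S : Finset (Fin n)) (b : Fin 2) :
    constOn S b = ∑ w ∈ S, Pi.single w b := by
  funext i; simp [constOn, Finset.sum_apply, Pi.single_apply]

theorem constOn_add (S : Finset (Fin n)) (a b : Fin 2) :
    constOn S (a + b) = constOn S a + constOn S b := by
  funext i; by_cases h : i ∈ S <;> simp [constOn, h]

theorem hasCost_add_constOn_apply {a : Fin n} (S : Finset (Fin n)) (ha : a ∉ S) :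
    HasCost #S fun x => x + constOn S (x a) := by
  convert hasCost_add_sum S (fun t x => Pi.single t (x a)) (fun _ => 1) ?_ ?_ using 1
  · simp
  · funext x; rw [constOn_eq_sum]
  · exact fun t ht => hasCost_cnot (ne_of_mem_of_not_mem ht ha).symm
  · intro i hi j hj _ x
    simp [(ne_of_mem_of_not_mem hi ha).symm]

/-- Over the field with two elements, `P = P₀ + x_d (P₀ + P₁)`. The second term has `d` as an
additional control, which doubles the cost of the leaves; hence the factor `1 + 2 = 3` per wire of
`D`. -/
theorem hasCost_addAt_conj_mul {t : Fin n} (D : Finset (Fin n)) :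
    ∀ A : Finset (Fin n), Disjoint A D → t ∉ A → t ∉ D → ∀ P, DependsOn P D →
      HasCost (3 * 2 ^ #A * 3 ^ #D) (addAt t fun x => conj A x * P x) := by
  induction D using Finset.induction_on with
  | empty =>
    intro A _ ht _ P hP
    have hc : ∀ x, P x = P 0 := fun x => hP _ _ (by simp)
    have h2 : P 0 = 0 ∨ P 0 = 1 := by omega
    rcases h2 with h | h
    · have : (addAt t fun x => conj A x * P x) = id := by
        funext x; simp [addAt, hc x, h]
      rw [this]; exact hasCost_id.mono (Nat.zero_le _)
    · have : (addAt t fun x => conj A x * P x) = addAt t (conj A) := by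
        funext x; simp [addAt, hc x, h]
      rw [this]; simpa using hasCost_addAt_conj A ht
  | insert d D hd ih =>
    intro A hA htA htD P hP
    simp only [mem_insert, not_or] at htD
    rw [disjoint_insert_right] at hA
    have hup : ∀ b, DependsOn (fun x => P (Function.update x d b)) D := fun b x y h =>
      hP _ _ fun e he => by
        by_cases hed : e = d
        · subst hed; simp
        · simp [hed, h e (mem_of_mem_insert_of_ne he hed)]
    have h1 := ih A hA.2 htA htD.2 _ (hup 0)
    have h2 := ih (insert d A) (disjoint_insert_left.2 ⟨hd, hA.2⟩) (by simp [htD.1, htA]) htD.2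
      (fun x => P (Function.update x d 0) + P (Function.update x d 1))
      (fun x y h => congrArg₂ (· + ·) (hup 0 x y h) (hup 1 x y h))
    convert h2.comp h1 using 1
    · rw [card_insert_of_notMem hd, card_insert_of_notMem hA.1]; ring
    · have hP0 : ∀ b x, P (Function.update (addAt t (fun x => conj A x *
          P (Function.update x d 0)) x) d b) = P (Function.update x d b) := fun b x =>
        hup b _ _ fun e he => addAt_apply_of_ne (ne_of_mem_of_not_mem he htD.2) ..
      have hc : conj (insert d A) = fun x => x d * conj A x := by
        funext x; exact prod_insert hA.1
      funext x
      rw [Function.comp_apply, addAt, addAt, hP0, hP0, hc]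
      simp only
      rw [addAt_apply_of_ne (Ne.symm htD.1),
        conj_congr fun e he => addAt_apply_of_ne (ne_of_mem_of_not_mem he htA) _ x,
        addAt, add_assoc, ← Pi.single_add]
      congr 2
      have hx : P x = P (Function.update x d (x d)) := by rw [Function.update_eq_self]
      rw [hx]
      have h2 : x d = 0 ∨ x d = 1 := by omega
      rcases h2 with h | h <;> rw [h] <;>
        generalize P (Function.update x d 0) = p, P (Function.update x d 1) = q, conj A x = r <;>
        revert p q r <;> decide

theorem hasCost_addAt {t : Fin n} {D : Finset (Fin n)} {P : Bits n → Fin 2} (hP : DependsOn P D)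
    (ht : t ∉ D) : HasCost (3 * 3 ^ #D) (addAt t P) := by
  simpa [conj] using hasCost_addAt_conj_mul D ∅ (disjoint_empty_left D) (notMem_empty t) ht P hP

theorem DependsOn.apply_add_constOn {P : Bits n → Fin 2} {D S : Finset (Fin n)}
    (h : DependsOn P D) (hS : Disjoint D S) (x : Bits n) (b : Fin 2) :
    P (x + constOn S b) = P x :=
  h _ _ fun d hd => by simp [constOn, disjoint_left.1 hS hd]

/-- Wire `a` is borrowed: it is copied to `S` before and after `P` is added to it, so its unknown
value cancels in `S`; adding `P` again restores `a`. The function is computed only twice, whatever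
the size of `S`. -/
theorem hasCost_add_constOn {a : Fin n} {D S : Finset (Fin n)} {P : Bits n → Fin 2}
    (hP : DependsOn P D) (haD : a ∉ D) (haS : a ∉ S) (hS : Disjoint D S) :
    HasCost (6 * 3 ^ #D + 2 * #S) fun x => x + constOn S (P x) := by
  have h := (hasCost_addAt hP haD).comp (hasCost_add_constOn_apply S haS)
  convert h.comp h using 1
  · ring
  · have e : ∀ x, (addAt a P ∘ fun x => x + constOn S (x a)) x =
        x + constOn S (x a) + Pi.single a (P x) := fun x => by
      simp only [Function.comp_apply, addAt, hP.apply_add_constOn hS]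
    funext x
    rw [Function.comp_apply, e, e, hP.apply_add_single haD, hP.apply_add_constOn hS]
    have e2 : (x + constOn S (x a) + Pi.single a (P x) : Bits n) a = x a + P x := by
      simp [constOn, haS]
    rw [e2, constOn_add]
    generalize constOn S (x a) = u, constOn S (P x) = v, (Pi.single a (P x) : Bits n) = w
    calc x + v = x + v + (u + u) + (w + w) := by simp [bits_add_self]
      _ = _ := by abel

/-! ### Transpositions -/

theorem HasCost.conj_swap {s r : ℕ} {σ : Bits n → Bits n} (hσ : HasCost s σ) {x y : Bits n}
    (h : HasCost r (Equiv.swap (σ x) (σ y))) : HasCost (2 * s + r) (Equiv.swap x y) := by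
  obtain ⟨g, hg⟩ := hσ.bijective.injective.hasLeftInverse
  convert ((hσ.inv hg).comp h).comp hσ using 1
  · ring
  · funext z
    simp only [Function.comp_apply]
    rw [hσ.bijective.injective.swap_apply, hg]

theorem addAt_conj_compl (t : Fin n) :
    addAt t (conj (univ.erase t)) = Equiv.swap (1 : Bits n) (1 + Pi.single t 1) := by
  have h1 : ∀ z : Bits n, (∀ c ∈ univ.erase t, z c = 1) → z = 1 ∨ z = 1 + Pi.single t 1 := by
    intro z hz
    have h2 : z t = 1 ∨ z t = 1 + 1 := by
      generalize z t = a; revert a; decide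
    refine h2.imp (fun h2 => ?_) (fun h2 => ?_) <;> funext j <;> by_cases hj : j = t
    · subst hj; exact h2
    · exact hz j (by simp [hj])
    · subst hj; simpa using h2
    · simpa [hj] using hz j (by simp [hj])
  funext z
  by_cases hz : ∀ c ∈ univ.erase t, z c = 1
  · have : conj (univ.erase t) z = 1 := prod_eq_one hz
    rw [addAt, this]
    rcases h1 z hz with rfl | rfl
    · simp
    · rw [Equiv.swap_apply_right, bits_add_add_self]
  · have h0 : conj (univ.erase t) z = 0 := by
      push Not at hz
      obtain ⟨c, hc, h⟩ := hz
      exact prod_eq_zero hc (by omega)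
    rw [addAt, h0, Pi.single_zero, add_zero, Equiv.swap_apply_of_ne_of_ne]
    · rintro rfl; exact hz fun _ _ => rfl
    · rintro rfl; exact hz fun c hc => by simp [(mem_erase.1 hc).1]

/-- A translation by `y`, CNOTs from a wire `t` where `x` and `y` differ, and a second translation
carry `x` and `y` to `1` and `1 + Pi.single t 1`. These are swapped by the NOT controlled by all
wires but `t`. -/
theorem hasCost_swap {x y : Bits n} (hxy : x ≠ y) : HasCost (9 * 2 ^ n) (Equiv.swap x y) := by
  obtain ⟨t, ht⟩ := Function.ne_iff.1 hxy
  set d : Bits n := x + y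
  have hd : d t = 1 := by
    simp only [d, Pi.add_apply]
    revert ht; generalize x t = a; generalize y t = b; revert a b; decide
  set S := univ.filter fun j => j ≠ t ∧ d j = 1
  have htS : t ∉ S := by simp [S]
  have h := (hasCost_add_const (1 + Pi.single t 1 : Bits n)).comp
    ((hasCost_add_constOn_apply S htS).comp (hasCost_add_const y))
  have hx : d + constOn S (d t) = Pi.single t 1 := by
    funext j
    have h2 : d j = 0 ∨ d j = 1 := by omega
    by_cases hj : j = t
    · subst hj; simp [hd, constOn, htS]
    · rcases h2 with h | h <;> simp [hj, S, h, constOn, hd]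
  have hs : HasCost (3 * 2 ^ n) (Equiv.swap (1 : Bits n) (1 + Pi.single t 1)) := by
    rw [← addAt_conj_compl]
    refine (hasCost_addAt_conj (univ.erase t) (by simp)).mono ?_
    gcongr
    · norm_num
    · simp
  refine (h.conj_swap (r := 3 * 2 ^ n) ?_).mono ?_
  · simp only [Function.comp_apply]
    have e0 : y + y + constOn S ((y + y) t) = 0 := by
      rw [bits_add_self]; funext j; simp [constOn]
    change HasCost _ (Equiv.swap (d + constOn S (d t) + _) _)
    rw [hx, e0, zero_add, add_comm, bits_add_add_self]
    exact hs
  · have h1 : n < 2 ^ n := Nat.lt_two_pow_self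
    have h2 : #S ≤ n := by simpa using card_le_univ S
    omega

/-! ### Multiply controlled NOT of linear size with borrowed wires -/

/-- The linear-size network of Toffoli gates with borrowed wires `B`: it adds the conjunction of
`A` to wire `t` and disturbs the wires in `B`. -/
theorem exists_ladder (A : Finset (Fin n)) (hA : A.Nonempty) : ∀ (B : Finset (Fin n)) (t : Fin n),
    Disjoint A B → t ∉ A → t ∉ B → #A ≤ #B + 1 → ∃ ρ, HasCost (24 * #A) ρ ∧
      ∀ x, ρ x t = x t + conj A x ∧ (∀ w, w ∉ B → w ≠ t → ρ x w = x w) ∧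
        ∀ w, w ∉ A → w ∉ B → w ≠ t → ∀ b, ρ (x + Pi.single w b) = ρ x + Pi.single w b := by
  induction hA using Finset.Nonempty.cons_induction with
  | singleton c =>
    intro B t _ htA htB _
    have hct : c ≠ t := by simpa [eq_comm] using htA
    refine ⟨_, (hasCost_cnot hct).mono (by simp), fun x => ⟨?_, ?_, ?_⟩⟩
    · simp [addAt_apply_self, conj]
    · exact fun w _ hw => addAt_apply_of_ne hw ..
    · intro w hwA _ _ b
      have : c ≠ w := by simpa [eq_comm] using hwA
      simp only [addAt, Pi.add_apply, Pi.single_eq_of_ne this, add_zero]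
      abel
  | cons c A hc hA ih =>
    intro B t hAB htA htB hcard
    rw [cons_eq_insert] at *
    rw [card_insert_of_notMem hc] at *
    rw [disjoint_insert_left] at hAB
    simp only [mem_insert, not_or] at htA
    have hB : 0 < #B := by have := hA.card_pos; omega
    obtain ⟨a, ha⟩ := card_pos.1 hB
    have haA : a ∉ A := disjoint_right.1 hAB.2 ha
    have hca : c ≠ a := (ne_of_mem_of_not_mem ha hAB.1).symm
    have hat : a ≠ t := ne_of_mem_of_not_mem ha htB
    obtain ⟨ρ, hρ, hρx⟩ := ih (B.erase a) a (hAB.2.mono_right (erase_subset _ _)) haA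
      (notMem_erase a B) (by rw [card_erase_of_mem ha]; omega)
    have hT : HasCost 12 (addAt t (conj {c, a})) := by
      refine (hasCost_addAt_conj {c, a} (by simp [htA.1, Ne.symm hat])).mono ?_
      rw [card_pair hca]; norm_num
    have hconj : conj {c, a} = fun x : Bits n => x c * x a := by
      funext x; exact prod_pair hca
    have hcB : c ∉ B.erase a := fun h => hAB.1 (mem_of_mem_erase h)
    have htB' : t ∉ B.erase a := fun h => htB (mem_of_mem_erase h)
    -- The two Toffoli gates see wire `a` before and after `conj A` is added to it, so its initial
    -- value cancels.
    have hcomp : ∀ x, (addAt t (conj {c, a}) ∘ ρ ∘ addAt t (conj {c, a})) x =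
        ρ x + Pi.single t (x c * conj A x) := by
      intro x
      simp only [Function.comp_apply, addAt, hconj]
      rw [(hρx x).2.2 t htA.2 htB' (Ne.symm hat)]
      simp only [Pi.add_apply, Pi.single_eq_of_ne (Ne.symm htA.1), Pi.single_eq_of_ne hat,
        add_zero]
      rw [(hρx x).1, (hρx x).2.1 c hcB hca, add_assoc, ← Pi.single_add]
      congr 2
      generalize x c = p, x a = q, conj A x = r
      revert p q r; decide
    refine ⟨_, (hT.comp (hρ.comp hT)).mono (by omega), fun x => ⟨?_, ?_, ?_⟩⟩
    · have e : conj (insert c A) x = x c * conj A x := prod_insert hc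
      rw [hcomp, Pi.add_apply, Pi.single_eq_same, (hρx x).2.1 t htB' (Ne.symm hat), e]
    · intro w hwB hwt
      rw [hcomp, Pi.add_apply, Pi.single_eq_of_ne hwt, add_zero]
      exact (hρx x).2.1 w (fun h => hwB (mem_of_mem_erase h)) (ne_of_mem_of_not_mem ha hwB).symm
    · intro w hwA hwB hwt b
      simp only [mem_insert, not_or] at hwA
      rw [hcomp, hcomp, (hρx x).2.2 w hwA.2 (fun h => hwB (mem_of_mem_erase h))
        (ne_of_mem_of_not_mem ha hwB).symm, (dependsOn_conj A).apply_add_single hwA.2]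
      simp only [Pi.add_apply, Pi.single_eq_of_ne (Ne.symm hwA.1), add_zero]
      abel

/-- The ladder `ρ` for `A.erase c` is undone before it is run, so the wires of `B` are restored.
Toffoli gates on both sides of the forward run leave in `t` the change of wire `a`, multiplied by `x
c`. -/
theorem hasCost_addAt_conj_of_card_le {A B : Finset (Fin n)} {t : Fin n} (hA : A.Nonempty)
    (hAB : Disjoint A B) (htA : t ∉ A) (htB : t ∉ B) (hcard : #A ≤ #B + 1) :
    HasCost (48 * #A) (addAt t (conj A)) := by
  by_cases h1 : #A = 1
  · exact (hasCost_addAt_conj A htA).mono (by simp [h1])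
  have hA0 := hA.card_pos
  obtain ⟨c, hc⟩ := hA
  obtain ⟨a, ha⟩ := card_pos.1 (show 0 < #B by omega)
  have haA : a ∉ A := disjoint_right.1 hAB ha
  have hca : c ≠ a := ne_of_mem_of_not_mem hc haA
  have hct : c ≠ t := ne_of_mem_of_not_mem hc htA
  have hat : a ≠ t := ne_of_mem_of_not_mem ha htB
  have hAe : #(A.erase c) = #A - 1 := card_erase_of_mem hc
  obtain ⟨ρ, hρ, hρx⟩ := exists_ladder (A.erase c) (card_pos.1 (by omega)) (B.erase a) a
    ((hAB.mono_left (erase_subset _ _)).mono_right (erase_subset _ _))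
    (fun h => haA (mem_of_mem_erase h)) (notMem_erase a B)
    (by rw [hAe, card_erase_of_mem ha]; omega)
  obtain ⟨g, hg⟩ := hρ.bijective.injective.hasLeftInverse
  have hT : HasCost 12 (addAt t (conj {c, a})) := by
    refine (hasCost_addAt_conj {c, a} (by simp [Ne.symm hct, Ne.symm hat])).mono ?_
    rw [card_pair hca]; norm_num
  have hconj : conj {c, a} = fun x : Bits n => x c * x a := by
    funext x; exact prod_pair hca
  have hcB : c ∉ B.erase a := fun h => disjoint_left.1 hAB hc (mem_of_mem_erase h)
  have htB' : t ∉ B.erase a := fun h => htB (mem_of_mem_erase h)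
  have htA' : t ∉ A.erase c := fun h => htA (mem_of_mem_erase h)
  convert (hT.comp (hρ.comp (hT.comp (hρ.inv hg)))).mono (show _ ≤ 48 * #A by omega) using 1
  funext x
  obtain ⟨y, rfl⟩ := hρ.bijective.surjective x
  have e : conj A (ρ y) = y c * conj (A.erase c) y := by
    rw [← (hρx y).2.1 c hcB hca, conj, ← mul_prod_erase A _ hc]
    congr 1
    refine conj_congr fun d hd => (hρx y).2.1 d (fun h => ?_) ?_
    · exact disjoint_left.1 hAB (mem_of_mem_erase hd) (mem_of_mem_erase h)
    · exact ne_of_mem_of_not_mem (mem_of_mem_erase hd) haA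
  simp only [Function.comp_apply, addAt, hconj, hg y, e]
  rw [(hρx y).2.2 t htA' htB' (Ne.symm hat)]
  simp only [Pi.add_apply, Pi.single_eq_of_ne hct, Pi.single_eq_of_ne hat, add_zero]
  rw [(hρx y).1, (hρx y).2.1 c hcB hca, add_assoc, ← Pi.single_add]
  congr 2
  generalize y c = p, y a = q, conj (A.erase c) y = r
  revert p q r; decide

/-- One borrowed wire suffices: `A` is halved, and each half lends its wires while the other is
evaluated. Repeating the two steps cancels the initial value of `d` in `t` and restores `d`. -/
theorem hasCost_addAt_conj_linear {A : Finset (Fin n)} {t d : Fin n} (htA : t ∉ A) (hdA : d ∉ A)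
    (hdt : d ≠ t) : HasCost (96 * (#A + 1)) (addAt t (conj A)) := by
  rcases A.eq_empty_or_nonempty with rfl | hA
  · exact (hasCost_addAt_conj ∅ htA).mono (by simp)
  have hA0 := hA.card_pos
  obtain ⟨A₁, hA₁, hc₁⟩ := exists_subset_card_eq (show (#A + 1) / 2 ≤ #A by omega)
  set A₂ := A \ A₁
  have hc₂ : #A₂ = #A - #A₁ := card_sdiff_of_subset hA₁
  have hdis : Disjoint A₁ A₂ := disjoint_sdiff
  have hdA₁ : d ∉ A₁ := fun h => hdA (hA₁ h)
  have hdA₂ : d ∉ A₂ := fun h => hdA (sdiff_subset h)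
  have htA₁ : t ∉ A₁ := fun h => htA (hA₁ h)
  have htA₂ : t ∉ A₂ := fun h => htA (sdiff_subset h)
  have h1 : HasCost (48 * #A₁) (addAt d (conj A₁)) :=
    hasCost_addAt_conj_of_card_le (B := insert t A₂) (card_pos.1 (by omega))
      (disjoint_insert_right.2 ⟨htA₁, hdis⟩) hdA₁ (by simp [hdt, hdA₂])
      (by rw [card_insert_of_notMem htA₂]; omega)
  have h2 : HasCost (48 * (#A₂ + 1)) (addAt t (conj (insert d A₂))) := by
    rw [← card_insert_of_notMem hdA₂]
    refine hasCost_addAt_conj_of_card_le (B := A₁) (insert_nonempty d A₂)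
      (disjoint_insert_left.2 ⟨hdA₁, hdis.symm⟩) (by simp [hdt.symm, htA₂]) htA₁ ?_
    rw [card_insert_of_notMem hdA₂]; omega
  convert ((h2.comp h1).comp (h2.comp h1)).mono (show _ ≤ 96 * (#A + 1) by omega) using 1
  have e : ∀ x, (addAt t (conj (insert d A₂)) ∘ addAt d (conj A₁)) x =
      x + Pi.single d (conj A₁ x) + Pi.single t ((x d + conj A₁ x) * conj A₂ x) := by
    intro x
    have e0 : conj (insert d A₂) = fun x => x d * conj A₂ x := by
      funext x; exact prod_insert hdA₂
    simp only [Function.comp_apply, addAt, e0, (dependsOn_conj A₂).apply_add_single hdA₂]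
    simp
  have e1 : ∀ x : Bits n, conj A x = conj A₁ x * conj A₂ x := fun x => by
    rw [mul_comm]; exact (prod_sdiff hA₁).symm
  funext x
  rw [Function.comp_apply, e, e]
  simp only [(dependsOn_conj A₂).apply_add_single hdA₂, (dependsOn_conj A₂).apply_add_single htA₂,
    (dependsOn_conj A₁).apply_add_single hdA₁, (dependsOn_conj A₁).apply_add_single htA₁,
    Pi.add_apply, Pi.single_eq_same, Pi.single_eq_of_ne hdt, add_zero, addAt, e1]
  generalize x d = p, conj A₁ x = q, conj A₂ x = r
  have hs : (Pi.single t (q * r) : Bits n) =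
      Pi.single t ((p + q) * r) + Pi.single t ((p + q + q) * r) := by
    rw [← Pi.single_add]; congr 1; revert p q r; decide
  rw [hs]
  calc _ = x + (Pi.single d q + Pi.single d q) + (Pi.single t ((p + q) * r) +
        Pi.single t ((p + q + q) * r)) := by rw [bits_add_self, add_zero]
    _ = _ := by abel


/-! ### Bringing `2 ^ q` strings to canonical form -/

/-- A new string agrees on `D` with at most one earlier string, so one more wire is enough to
separate it. -/
theorem exists_distinguishing_wires {ι : Type*} [DecidableEq ι] {z : ι → Bits n}
    (hz : Function.Injective z) (R : Finset ι) : ∃ D : Finset (Fin n), #D ≤ #R ∧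
      ∀ i ∈ R, ∀ j ∈ R, (∀ d ∈ D, z i d = z j d) → i = j := by
  induction R using Finset.induction_on with
  | empty => exact ⟨∅, by simp⟩
  | insert i R hi ih =>
    obtain ⟨D, hD, h⟩ := ih
    rw [card_insert_of_notMem hi]
    by_cases hj : ∃ j ∈ R, ∀ d ∈ D, z i d = z j d
    · obtain ⟨j, hjR, hj⟩ := hj
      obtain ⟨d, hd⟩ := Function.ne_iff.1 (hz.ne (ne_of_mem_of_not_mem hjR hi).symm)
      have key : ∀ k ∈ R, ¬ ∀ e ∈ insert d D, z i e = z k e := fun k hk hik => by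
        have : k = j := h k hk j hjR fun e he => by
          rw [← hik e (mem_insert_of_mem he), hj e he]
        subst this
        exact hd (hik d (mem_insert_self d D))
      refine ⟨insert d D, (card_insert_le d D).trans (by omega), fun a ha b hb hab => ?_⟩
      rcases mem_insert.1 ha with rfl | ha' <;> rcases mem_insert.1 hb with rfl | hb'
      · rfl
      · exact (key b hb' hab).elim
      · exact (key a ha' fun e he => (hab e he).symm).elim
      · exact h a ha' b hb' fun e he => hab e (mem_insert_of_mem he)
    · push Not at hj
      refine ⟨D, by omega, fun a ha b hb hab => ?_⟩
      rcases mem_insert.1 ha with rfl | ha' <;> rcases mem_insert.1 hb with rfl | hb'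
      · rfl
      · obtain ⟨d, hd, hne⟩ := hj b hb'
        exact (hne (hab d hd)).elim
      · obtain ⟨d, hd, hne⟩ := hj a ha'
        exact (hne (hab d hd).symm).elim
      · exact h a ha' b hb' hab

/-- The wires in `D` determine `b`. The address wires lie outside `D`, so overwriting them never
destroys the information from which the remaining corrections are computed. -/
theorem exists_write_address {q : ℕ} {z : Bits q → Bits n} {D : Finset (Fin n)}
    (hD : ∀ b c, (∀ d ∈ D, z b d = z c d) → b = c) {e : Fin q → Fin n}
    (he : Function.Injective e) (heD : ∀ j, e j ∉ D) :
    ∃ σ, HasCost (q * (3 * 3 ^ #D)) σ ∧ ∀ b, (∀ j, σ (z b) (e j) = b j) ∧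
      ∀ w, w ∉ Set.range e → σ (z b) w = z b w := by
  classical
  let g : Bits n → Bits q := fun x => Classical.epsilon fun b => ∀ d ∈ D, x d = z b d
  have hg : ∀ b, g (z b) = b := fun b =>
    (hD _ _ (Classical.epsilon_spec (p := fun c => ∀ d ∈ D, z b d = z c d) ⟨b, fun _ _ => rfl⟩)).symm
  have hgD : ∀ x y : Bits n, (∀ d ∈ D, x d = y d) → g x = g y := fun x y h => by
    have : (fun b => ∀ d ∈ D, x d = z b d) = fun b => ∀ d ∈ D, y d = z b d := by
      funext b
      exact propext (forall₂_congr fun d hd => by rw [h d hd])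
    simp only [g, this]
  have hP : ∀ j, DependsOn (fun x => z (g x) (e j) + g x j) D := fun j x y h => by
    simp only [hgD x y h]
  have hσ := hasCost_add_sum (univ : Finset (Fin q))
    (fun j x => Pi.single (e j) (z (g x) (e j) + g x j)) (fun _ => 3 * 3 ^ #D)
    (fun j _ => hasCost_addAt (hP j) (heD j))
    (fun i _ j _ _ x => congrArg _ ((hP j).apply_add_single (heD i) x _))
  rw [sum_const, card_univ, Fintype.card_fin, smul_eq_mul] at hσ
  refine ⟨_, hσ, fun b => ⟨fun j => ?_, fun w hw => ?_⟩⟩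
  · simp only [Pi.add_apply, Finset.sum_apply, hg]
    rw [sum_eq_single j (fun i _ hi => Pi.single_eq_of_ne (he.ne hi.symm) _) (by simp),
      Pi.single_eq_same, ← add_assoc, fin_two_add_self, zero_add]
  · simp only [Pi.add_apply, Finset.sum_apply]
    rw [sum_eq_zero fun i _ => Pi.single_eq_of_ne (fun h => hw ⟨i, h.symm⟩) _, add_zero]

/-- Wires whose columns in a table with `2 ^ q` rows are equal get the same correction, so that
each correction is computed only once and copied by CNOT gates. -/
theorem exists_write_columns {q : ℕ} {e : Fin q → Fin n} {a : Fin n} (ha : a ∉ Set.range e)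
    (col : Fin n → Bits q → Fin 2) :
    ∃ σ, HasCost (2 ^ 2 ^ q * (6 * 3 ^ q) + 2 * n + 3 * 3 ^ q) σ ∧ ∀ x,
      (∀ j, σ x (e j) = x (e j)) ∧ ∀ w, w ∉ Set.range e → σ x w = x w + col w fun j => x (e j) := by
  classical
  let Q : Finset (Fin n) := univ.image e
  have hQ : ∀ w, w ∈ Q ↔ w ∈ Set.range e := fun w => by simp [Q]
  have hQc : #Q ≤ q := card_image_le.trans (by simp)
  let W : Finset (Fin n) := univ.filter fun w => w ∉ Q ∧ w ≠ a
  let S : (Bits q → Fin 2) → Finset (Fin n) := fun h => W.filter fun w => col w = h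
  have hdep : ∀ h : Bits q → Fin 2, DependsOn (fun x => h fun j => x (e j)) Q := fun h x y hxy =>
    congrArg h (funext fun j => hxy _ ((hQ _).2 ⟨j, rfl⟩))
  have haQ : a ∉ Q := fun h => ha ((hQ a).1 h)
  have hS : ∀ h, Disjoint Q (S h) := fun h => disjoint_left.2 fun w hw hw' =>
    (mem_filter.1 (mem_filter.1 hw').1).2.1 hw
  have haS : ∀ h, a ∉ S h := fun h hw => (mem_filter.1 (mem_filter.1 hw).1).2.2 rfl
  -- Wire `a` is the borrowed wire for all columns; its own column is added separately afterwards.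
  have h1 := hasCost_add_sum (univ : Finset (Bits q → Fin 2))
    (fun h x => constOn (S h) (h fun j => x (e j))) (fun h => 6 * 3 ^ #Q + 2 * #(S h))
    (fun h _ => hasCost_add_constOn (hdep h) haQ (haS h) (hS h))
    (fun h _ h' _ _ x => congrArg _ ((hdep h').apply_add_constOn (hS h) x _))
  have h2 := hasCost_addAt (hdep (col a)) haQ
  have hsum : ∑ h : Bits q → Fin 2, #(S h) ≤ n := by
    rw [← card_eq_sum_card_fiberwise (f := col) (s := W) (t := univ) (fun _ _ => by simp)]
    simpa using card_le_univ W
  refine ⟨_, (h2.comp h1).mono ?_, fun x => ?_⟩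
  · have : Fintype.card (Bits q → Fin 2) = 2 ^ 2 ^ q := by simp
    rw [sum_add_distrib, sum_const, ← mul_sum, smul_eq_mul, card_univ, this]
    gcongr <;> norm_num
  · set y := x + ∑ h, constOn (S h) (h fun j => x (e j)) with hy
    have hyx : ∀ w, y w = x w + if w ∈ W then col w fun j => x (e j) else 0 := fun w => by
      rw [hy, Pi.add_apply, Finset.sum_apply]
      congr 1
      simp only [constOn, S, mem_filter]
      by_cases hw : w ∈ W
      · simp [hw]
      · simp [hw]
    have hyQ : ∀ j, y (e j) = x (e j) := fun j => by
      rw [hyx, if_neg, add_zero]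
      intro h
      exact (mem_filter.1 h).2.1 ((hQ _).2 ⟨j, rfl⟩)
    simp only [Function.comp_apply]
    rw [← hy]
    refine ⟨fun j => ?_, fun w hw => ?_⟩
    · rw [addAt_apply_of_ne (fun h => ha ⟨j, h⟩), hyQ]
    · by_cases hwa : w = a
      · subst hwa
        have : w ∉ W := by simp [W]
        rw [addAt_apply_self, hyx, if_neg this, add_zero]
        simp only [hyQ]
      · have : w ∈ W := by simpa [W, hwa, hQ] using hw
        rw [addAt_apply_of_ne hwa, hyx, if_pos this]

/-- Once the address is written, each other wire holds a known function of it, and adding the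
complement of that function leaves a one. -/
theorem exists_canonical_form {q : ℕ} {z : Bits q → Bits n} (hz : Function.Injective z)
    (hn : 2 ^ q + q ≤ n) : ∃ e : Fin q → Fin n, Function.Injective e ∧
      ∃ σ, HasCost (q * (3 * 3 ^ 2 ^ q) + (2 ^ 2 ^ q * (6 * 3 ^ q) + 2 * n + 3 * 3 ^ q)) σ ∧
        ∀ b, (∀ j, σ (z b) (e j) = b j) ∧ ∀ w, w ∉ Set.range e → σ (z b) w = 1 := by
  classical
  obtain ⟨D, hDc, hD⟩ := exists_distinguishing_wires hz univ
  have hDc' : #D ≤ 2 ^ q := by simpa using hDc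
  obtain ⟨Q, hQ, hQc⟩ := exists_subset_card_eq (s := univ \ D) (n := q) (by
    rw [card_sdiff_of_subset (subset_univ D)]; simp; omega)
  let e : Fin q → Fin n := Q.orderEmbOfFin hQc
  have he : Function.Injective e := (Q.orderEmbOfFin hQc).injective
  have heD : ∀ j, e j ∉ D := fun j => (mem_sdiff.1 (hQ (orderEmbOfFin_mem Q hQc j))).2
  have hpos : 0 < 2 ^ q := by positivity
  obtain ⟨a, -, ha⟩ := exists_mem_notMem_of_card_lt_card (s := Q) (t := univ) (by simp; omega)
  have ha' : a ∉ Set.range e := fun ⟨j, hj⟩ => ha (hj ▸ orderEmbOfFin_mem Q hQc j)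
  obtain ⟨σ₁, h₁, hσ₁⟩ := exists_write_address
    (fun b c h => hD b (mem_univ b) c (mem_univ c) h) he heD
  obtain ⟨σ₂, h₂, hσ₂⟩ := exists_write_columns ha' fun w b => z b w + 1
  refine ⟨e, he, σ₂ ∘ σ₁, (h₂.comp h₁).mono (by gcongr; norm_num), fun b => ⟨fun j => ?_,
    fun w hw => ?_⟩⟩
  · rw [Function.comp_apply, (hσ₂ _).1, (hσ₁ b).1]
  · rw [Function.comp_apply, (hσ₂ _).2 w hw, (hσ₁ b).2 w hw]
    simp only [(hσ₁ b).1]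
    rw [← add_assoc, fin_two_add_self, zero_add]

/-! ### Exchanging many pairs at once -/

/-- An upper bound for the number of gates that exchange `2 ^ (q - 1)` disjoint pairs of strings. -/
def groupCost (n q : ℕ) : ℕ :=
  2 * (q * (3 * 3 ^ 2 ^ q) + (2 ^ 2 ^ q * (6 * 3 ^ q) + 2 * n + 3 * 3 ^ q)) + 96 * (n + 1)

/-- The canonical strings are exactly those with ones off the address, so a NOT on `e 0` controlled
by all non-address wires pairs them and fixes every other string. Address length at least two leaves
`e 1` to be borrowed. -/
theorem exists_hasCost_exchange {p : ℕ} {z : Bits (p + 2) → Bits n} (hz : Function.Injective z)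
    (hn : 2 ^ (p + 2) + (p + 2) ≤ n) : ∃ G, HasCost (groupCost n (p + 2)) G ∧
      (∀ b, G (z b) = z (b + Pi.single 0 1)) ∧ ∀ x, x ∉ Set.range z → G x = x := by
  classical
  obtain ⟨e, he, σ, hσ, hσz⟩ := exists_canonical_form hz hn
  obtain ⟨g, hg⟩ := hσ.bijective.injective.hasLeftInverse
  let A : Finset (Fin n) := univ.filter fun w => w ∉ Set.range e
  have hA : ∀ w, w ∈ A ↔ w ∉ Set.range e := fun w => by simp [A]
  have hτ : HasCost (96 * (n + 1)) (addAt (e 0) (conj A)) :=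
    (hasCost_addAt_conj_linear (d := e 1) (fun h => (hA _).1 h ⟨0, rfl⟩)
      (fun h => (hA _).1 h ⟨1, rfl⟩) (he.ne (by simp))).mono (by
        gcongr; simpa using card_le_univ A)
  refine ⟨_, (((hσ.inv hg).comp hτ).comp hσ).mono (by rw [groupCost]; omega), fun b => ?_,
    fun x hx => ?_⟩
  · have h1 : conj A (σ (z b)) = 1 := prod_eq_one fun w hw => (hσz b).2 w ((hA w).1 hw)
    have h2 : addAt (e 0) (conj A) (σ (z b)) = σ (z (b + Pi.single 0 1)) := by
      rw [addAt, h1]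
      funext w
      by_cases hw : w ∈ Set.range e
      · obtain ⟨j, rfl⟩ := hw
        rw [Pi.add_apply, (hσz _).1, (hσz _).1, Pi.add_apply]
        congr 1
        by_cases hj : j = 0
        · subst hj; simp
        · rw [Pi.single_eq_of_ne (he.ne hj), Pi.single_eq_of_ne hj]
      · rw [Pi.add_apply, (hσz _).2 w hw, (hσz _).2 w hw,
          Pi.single_eq_of_ne (fun h => hw ⟨0, h.symm⟩), add_zero]
    simp only [Function.comp_apply, h2, hg _]
  · have h0 : conj A (σ x) = 0 := by
      by_contra h
      have h1 : ∀ w ∈ A, σ x w = 1 := fun w hw => by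
        by_contra hne
        exact h (prod_eq_zero hw (by omega))
      refine hx ⟨fun j => σ x (e j), hσ.bijective.injective ?_⟩
      funext w
      by_cases hw : w ∈ Set.range e
      · obtain ⟨j, rfl⟩ := hw
        rw [(hσz _).1]
      · rw [(hσz _).2 w hw, h1 w ((hA w).2 hw)]
    simp only [Function.comp_apply, addAt, h0, Pi.single_zero, add_zero, hg x]

/-! ### Shrinking the support of a permutation -/

/-- Greedy choice: a new point must avoid only `T`, its image and its preimage, at most `3 * #T`
points. -/
theorem exists_disjoint_image {α : Type*} [Fintype α] [DecidableEq α] (f : Equiv.Perm α) (k : ℕ)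
    (hk : 3 * k ≤ #f.support) :
    ∃ T : Finset α, #T = k ∧ T ⊆ f.support ∧ ∀ x ∈ T, f x ∉ T := by
  induction k with
  | zero => exact ⟨∅, by simp⟩
  | succ k ih =>
    obtain ⟨T, hT, hTs, hTf⟩ := ih (by omega)
    have hc : #(T ∪ T.image f ∪ T.image f.symm) < #f.support := by
      have h1 := card_union_le (T ∪ T.image f) (T.image f.symm)
      have h2 := card_union_le T (T.image f)
      have h3 : #(T.image f) ≤ #T := card_image_le
      have h4 : #(T.image f.symm) ≤ #T := card_image_le
      omega
    obtain ⟨x, hx, hxT⟩ := exists_mem_notMem_of_card_lt_card hc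
    simp only [mem_union, mem_image, not_or, not_exists, not_and] at hxT
    refine ⟨insert x T, by rw [card_insert_of_notMem hxT.1.1, hT], insert_subset hx hTs, ?_⟩
    intro y hy
    rw [mem_insert, not_or]
    rcases mem_insert.1 hy with rfl | hy
    · exact ⟨Equiv.Perm.mem_support.1 hx, fun h => hxT.2 _ h (f.symm_apply_apply y)⟩
    · exact ⟨hxT.1.2 y hy, hTf y hy⟩

theorem hasCost_of_card_support_le (s : ℕ) : ∀ f : Equiv.Perm (Bits n), #f.support ≤ s →
    HasCost (s * (9 * 2 ^ n)) f := by
  induction s with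
  | zero =>
    intro f hf
    have : f = 1 := by simpa using hf
    subst this
    exact hasCost_id.mono (by simp)
  | succ s ih =>
    intro f hf
    by_cases h1 : f = 1
    · subst h1
      exact hasCost_id.mono (by simp)
    obtain ⟨x, hx⟩ : ∃ x, f x ≠ x := by
      by_contra! h
      exact h1 (Equiv.ext h)
    have h2 := Equiv.Perm.card_support_swap_mul hx
    have h3 := (hasCost_swap (Ne.symm hx)).comp (ih (Equiv.swap x (f x) * f) (by omega))
    convert h3 using 1
    · ring
    · funext y
      simp

theorem exists_hasCost_card_support_mul_le {p : ℕ} (hn : 2 ^ (p + 2) + (p + 2) ≤ n)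
    (f : Equiv.Perm (Bits n)) (hf : 3 * 2 ^ (p + 1) ≤ #f.support) :
    ∃ G : Equiv.Perm (Bits n), HasCost (groupCost n (p + 2)) G ∧
      #(G * f).support + 2 ^ (p + 1) ≤ #f.support := by
  classical
  obtain ⟨T, hT, hTs, hTf⟩ := exists_disjoint_image f _ hf
  let u : Bits (p + 1) ≃ T := Fintype.equivOfCardEq (by simp [hT])
  -- Bit `0` of the address tells `x` in `T` from its partner `f x`, so flipping it exchanges the
  -- two.
  let z : Bits (p + 2) → Bits n := fun b =>
    if b 0 = 0 then (u (Fin.tail b) : Bits n) else f (u (Fin.tail b))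
  have hz : Function.Injective z := by
    intro b c hbc
    have key : b 0 = c 0 ∧ Fin.tail b = Fin.tail c := by
      simp only [z] at hbc
      split_ifs at hbc with h1 h2 h2
      · exact ⟨h1.trans h2.symm, u.injective (Subtype.ext hbc)⟩
      · exact (hTf _ (u (Fin.tail c)).2 (hbc ▸ (u (Fin.tail b)).2)).elim
      · exact (hTf _ (u (Fin.tail b)).2 (hbc ▸ (u (Fin.tail c)).2)).elim
      · exact ⟨by omega, u.injective (Subtype.ext (f.injective hbc))⟩
    rw [← Fin.cons_self_tail b, ← Fin.cons_self_tail c, key.1, key.2]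
  obtain ⟨G, hG, hGz, hGx⟩ := exists_hasCost_exchange hz hn
  have hGf : ∀ x ∈ T, G (f x) = x := by
    intro x hx
    have h1 := hGz (Fin.cons 1 (u.symm ⟨x, hx⟩))
    have h2 : (Fin.cons 1 (u.symm ⟨x, hx⟩) + Pi.single 0 1 : Bits (p + 2)) =
        Fin.cons 0 (u.symm ⟨x, hx⟩) := by
      funext j
      refine Fin.cases ?_ (fun i => ?_) j
      · simp
      · simp
    rw [h2] at h1
    simpa [z] using h1
  refine ⟨Equiv.ofBijective G hG.bijective, hG, ?_⟩
  rw [← hT, ← card_union_of_disjoint]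
  · refine card_le_card (union_subset (fun x hx => ?_) hTs)
    by_contra hxf
    have hfx : f x = x := by simpa using hxf
    refine Equiv.Perm.mem_support.1 hx ?_
    change G (f x) = x
    rw [hfx]
    refine hGx x fun ⟨b, hb⟩ => hxf ?_
    simp only [z] at hb
    split_ifs at hb
    · exact hb ▸ hTs (u (Fin.tail b)).2
    · have : x = u (Fin.tail b) := f.injective (hfx.trans hb.symm)
      exact this ▸ hTs (u (Fin.tail b)).2
  · refine disjoint_left.2 fun x hx hxT => Equiv.Perm.mem_support.1 hx ?_
    exact hGf x hxT

theorem hasCost_of_card_support_le_mul {p : ℕ} (hn : 2 ^ (p + 2) + (p + 2) ≤ n) (m : ℕ) :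
    ∀ f : Equiv.Perm (Bits n), #f.support ≤ (m + 3) * 2 ^ (p + 1) →
      HasCost (m * groupCost n (p + 2) + 3 * 2 ^ (p + 1) * (9 * 2 ^ n)) f := by
  induction m with
  | zero =>
    intro f hf
    simpa using hasCost_of_card_support_le _ f hf
  | succ m ih =>
    intro f hf
    rcases le_total (3 * 2 ^ (p + 1)) #f.support with h | h
    · obtain ⟨G, hG, hGf⟩ := exists_hasCost_card_support_mul_le hn f h
      have h1 := ih (G * f) (by
        have : (m + 1 + 3) * 2 ^ (p + 1) = (m + 3) * 2 ^ (p + 1) + 2 ^ (p + 1) := by ring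
        omega)
      convert (hG.inv (g := G.symm) G.symm_apply_apply).comp h1 using 1
      · ring
      · funext x
        simp
    · exact (hasCost_of_card_support_le _ f h).mono (by simp)

/-! ### Choice of the group size and the upper bound -/

theorem groupCost_le {q : ℕ} (h : 8 ^ 2 ^ q ≤ n) : groupCost n q ≤ 300 * n := by
  set M := 2 ^ q with hM
  have hq : q ≤ 2 ^ M := Nat.lt_two_pow_self.le.trans Nat.lt_two_pow_self.le
  have hM2 : M ≤ 2 ^ M := Nat.lt_two_pow_self.le
  have e8 : 2 ^ M * 4 ^ M = 8 ^ M := by norm_num [← mul_pow]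
  have e4 : 2 ^ M * 2 ^ M = 4 ^ M := by norm_num [← mul_pow]
  have h3M : 3 ^ M ≤ 4 ^ M := Nat.pow_le_pow_left (by norm_num) M
  have h3q : 3 ^ q ≤ 4 ^ M := calc
    3 ^ q ≤ 4 ^ q := Nat.pow_le_pow_left (by norm_num) q
    _ = M * M := by norm_num [hM, ← mul_pow]
    _ ≤ 2 ^ M * 2 ^ M := Nat.mul_le_mul hM2 hM2
    _ = 4 ^ M := e4
  have h48 : 4 ^ M ≤ 8 ^ M := Nat.pow_le_pow_left (by norm_num) M
  have h1 : q * 3 ^ M ≤ 8 ^ M := e8 ▸ Nat.mul_le_mul hq h3M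
  have h2 : 2 ^ M * 3 ^ q ≤ 8 ^ M := e8 ▸ Nat.mul_le_mul_left _ h3q
  have h0 : 0 < 8 ^ M := by positivity
  have e : groupCost n q =
      6 * (q * 3 ^ M) + 12 * (2 ^ M * 3 ^ q) + 4 * n + 6 * 3 ^ q + 96 * n + 96 := by
    rw [groupCost]; ring
  rw [e]
  omega

/-- The exponent `q = p + 2` is the largest with `3 * 2 ^ q ≤ log₂ n`, rounded down. The threshold
`4096 = 2 ^ 12` makes `q ≥ 2`. -/
theorem exists_scale (hn : 4096 ≤ n) :
    ∃ p : ℕ, 8 ^ 2 ^ (p + 2) ≤ n ∧ Real.log n ≤ 12 * 2 ^ (p + 1) := by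
  set L := Nat.log 2 n with hL
  have hL12 : 12 ≤ L := (Nat.le_log_iff_pow_le (by norm_num) (by omega)).2 (by omega)
  have hlow : 2 ^ L ≤ n := Nat.pow_log_le_self 2 (by omega)
  have hup : n < 2 ^ (L + 1) := Nat.lt_pow_succ_log_self (by norm_num) n
  set q := Nat.log 2 (L / 3) with hq
  have hq2 : 2 ≤ q := (Nat.le_log_iff_pow_le (by norm_num) (by omega)).2 (by omega)
  have hqlow : 2 ^ q ≤ L / 3 := Nat.pow_log_le_self 2 (by omega)
  have hqup : L / 3 < 2 ^ (q + 1) := Nat.lt_pow_succ_log_self (by norm_num) _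
  obtain ⟨p, hp⟩ := Nat.exists_eq_add_of_le' hq2
  refine ⟨p, ?_, ?_⟩
  · rw [← hp]
    calc 8 ^ 2 ^ q = 2 ^ (3 * 2 ^ q) := by rw [pow_mul]; norm_num
      _ ≤ 2 ^ L := Nat.pow_le_pow_right (by norm_num) (by omega)
      _ ≤ n := hlow
  · have h1 : L + 1 ≤ 12 * 2 ^ (p + 1) := by
      have : 2 ^ (q + 1) = 4 * 2 ^ (p + 1) := by rw [hp]; ring
      omega
    have h2 : Real.log n ≤ (L + 1 : ℕ) * Real.log 2 := by
      rw [← Real.log_pow]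
      exact Real.log_le_log (by positivity) (by exact_mod_cast hup.le)
    have h3 : Real.log 2 ≤ 1 := by linarith [Real.log_two_lt_d9]
    calc Real.log n ≤ (L + 1 : ℕ) * Real.log 2 := h2
      _ ≤ (L + 1 : ℕ) * 1 := by gcongr
      _ ≤ 12 * 2 ^ (p + 1) := by rw [mul_one]; exact_mod_cast h1

theorem exists_hasCost_of_large (hn : 4096 ≤ n) (f : Equiv.Perm (Bits n)) :
    ∃ s : ℕ, HasCost s f ∧ (s : ℝ) ≤ 4000 * (2 ^ n * n / Real.log n) := by
  obtain ⟨p, h8, hlog⟩ := exists_scale hn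
  have hk8 : 2 ^ (p + 2) * 2 ^ (p + 2) ≤ n := by
    have h2 : 2 ^ (p + 2) ≤ 2 ^ 2 ^ (p + 2) := Nat.lt_two_pow_self.le
    calc _ ≤ 2 ^ 2 ^ (p + 2) * 2 ^ 2 ^ (p + 2) := Nat.mul_le_mul h2 h2
      _ = 4 ^ 2 ^ (p + 2) := by norm_num [← mul_pow]
      _ ≤ 8 ^ 2 ^ (p + 2) := Nat.pow_le_pow_left (by norm_num) _
      _ ≤ n := h8
  have hk4 : 4 ≤ 2 ^ (p + 2) := by rw [pow_add]; have := Nat.one_le_two_pow (n := p); omega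
  have hpk : p + 2 < 2 ^ (p + 2) := Nat.lt_two_pow_self
  have hq : 2 ^ (p + 2) + (p + 2) ≤ n := by nlinarith
  set k := 2 ^ (p + 1) with hk
  obtain ⟨m, hm⟩ : k ∣ 2 ^ n := pow_dvd_pow 2 (by omega)
  have h := hasCost_of_card_support_le_mul hq m f (by
    refine (card_le_univ _).trans ?_
    have : Fintype.card (Bits n) = 2 ^ n := by simp
    rw [this, hm, ← hk]
    nlinarith)
  refine ⟨_, h.mono (r := m * (300 * n) + 3 * k * (9 * 2 ^ n)) ?_, ?_⟩
  · gcongr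
    exact groupCost_le h8
  · have hl : 0 < Real.log n := Real.log_pos (by exact_mod_cast (by omega : 1 < n))
    have hkpos : (0 : ℝ) < k := by rw [hk]; positivity
    have hlk : Real.log n ≤ 12 * k := by rw [hk]; push_cast; exact hlog
    -- The transpositions for the last `3 * k` points cost `27 * k * 2 ^ n`; `k * k ≤ n` keeps this
    -- within the bound.
    have hkn : (k : ℝ) * k ≤ n := by
      have : k * k ≤ n := by
        have : 2 ^ (p + 2) = 2 * k := by rw [hk]; ring
        nlinarith
      exact_mod_cast this
    have hmr : (2 : ℝ) ^ n = k * m := by exact_mod_cast hm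
    rw [← mul_div_assoc, le_div_iff₀ hl]
    push_cast
    rw [hmr]
    have hm0 : (0 : ℝ) ≤ m := by positivity
    have hn0 : (0 : ℝ) ≤ n := by positivity
    have h1 : (m : ℝ) * n * Real.log n ≤ m * n * (12 * k) := by gcongr
    have h2 : (k : ℝ) * (k * m) * Real.log n ≤ k * (k * m) * (12 * k) := by gcongr
    have h3 : (k : ℝ) * (k * m) * (12 * k) ≤ 12 * (k * m) * n := by
      calc (k : ℝ) * (k * m) * (12 * k) = 12 * (k * m) * (k * k) := by ring
        _ ≤ _ := by gcongr
    have h4 : (0 : ℝ) ≤ k * m * n := by positivity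
    linarith

theorem one_le_div_log (hn : 2 ≤ n) : 1 ≤ n / Real.log n := by
  have hl : 0 < Real.log n := Real.log_pos (by exact_mod_cast (by omega : 1 < n))
  rw [le_div_iff₀ hl, one_mul]
  have := Real.log_le_sub_one_of_pos (x := n) (by positivity)
  linarith

theorem exists_hasCost_of_lt {N : ℕ} (hn : 2 ≤ n) (hN : n < N) (f : Equiv.Perm (Bits n)) :
    ∃ s : ℕ, HasCost s f ∧ (s : ℝ) ≤ 9 * 2 ^ N * (2 ^ n * n / Real.log n) := by
  refine ⟨_, hasCost_of_card_support_le (2 ^ n) f ((card_le_univ _).trans (by simp)), ?_⟩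
  have h1 := one_le_div_log hn
  have h2 : (2 : ℝ) ^ n ≤ 2 ^ N := pow_le_pow_right₀ (by norm_num) hN.le
  push_cast
  calc (2 : ℝ) ^ n * (9 * 2 ^ n) = 9 * 2 ^ n * 2 ^ n * 1 := by ring
    _ ≤ 9 * 2 ^ N * 2 ^ n * (n / Real.log n) := by gcongr
    _ = _ := by ring

theorem exists_upper_bound : ∃ C : ℝ, 0 < C ∧ ∀ n : ℕ, 2 ≤ n → ∀ f : Bits n → Bits n,
    Function.Bijective f → ∃ K : Circuit n, Computes K f ∧
      (K.length : ℝ) ≤ C * (2 ^ n * n / Real.log n) := by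
  -- The threshold is made opaque so that `2 ^ N` is never evaluated.
  obtain ⟨N, hN⟩ : ∃ N, N = 4096 := ⟨_, rfl⟩
  refine ⟨4000 + 9 * 2 ^ N, by positivity, fun n hn f hf => ?_⟩
  have hl : 0 < Real.log n := Real.log_pos (by exact_mod_cast (by omega : 1 < n))
  have hB : 0 ≤ 2 ^ n * n / Real.log n := by positivity
  have hN0 : (0 : ℝ) ≤ 9 * 2 ^ N := by positivity
  have key : ∃ s : ℕ, HasCost s f ∧ (s : ℝ) ≤ (4000 + 9 * 2 ^ N) * (2 ^ n * n / Real.log n) := by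
    rcases le_or_gt N n with h | h
    · obtain ⟨s, h1, h2⟩ := exists_hasCost_of_large (by omega) (Equiv.ofBijective f hf)
      exact ⟨s, h1, h2.trans (by gcongr; linarith)⟩
    · obtain ⟨s, h1, h2⟩ := exists_hasCost_of_lt hn h (Equiv.ofBijective f hf)
      exact ⟨s, h1, h2.trans (by gcongr; linarith)⟩
  obtain ⟨s, ⟨g, K, L, -, -, hK, -, hs, -⟩, h⟩ := key
  exact ⟨K, hK, le_trans (by exact_mod_cast hs) h⟩

/-! ### Lower bound by counting -/

/-- Every gate operator on `n` wires is a value of this function; the value `1` serves to pad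
circuits to a common length. -/
noncomputable def opOfCode (γ : Fin 11 × Fin n × Fin n × Fin n) : Op n :=
  match γ with
  | (0, _, _, t) => onWire matX t
  | (1, _, _, t) => onWire matS t
  | (2, _, _, t) => onWire matT t
  | (3, _, _, t) => onWire matH t
  | (4, _, c, t) => ctrl matX c t
  | (5, _, c, t) => ctrl (matRx Real.pi) c t
  | (6, k, c, t) => ctrl (matRx (Real.pi / 2 ^ (k : ℕ))) c t
  | (7, k, c, t) => ctrl (matRx (-(Real.pi / 2 ^ (k : ℕ)))) c t
  | (8, i, c, t) => ctrl (matV i) c t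
  | (9, i, c, t) => ctrl (matV i).conjTranspose c t
  | (10, _, _, _) => 1

theorem exists_opOfCode_eq (g : Gate n) : ∃ γ, opOfCode γ = g.op := by
  cases g with
  | gateNot t => exact ⟨(0, t, t, t), rfl⟩
  | gateS t => exact ⟨(1, t, t, t), rfl⟩
  | gateT t => exact ⟨(2, t, t, t), rfl⟩
  | gateH t => exact ⟨(3, t, t, t), rfl⟩
  | cnot c t h => exact ⟨(4, t, c, t), rfl⟩
  | crx θ hθ c t h =>
    rcases hθ with rfl | ⟨k, -, hk, rfl | rfl⟩
    · exact ⟨(5, t, c, t), rfl⟩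
    · exact ⟨(6, ⟨k, by omega⟩, c, t), rfl⟩
    · exact ⟨(7, ⟨k, by omega⟩, c, t), rfl⟩
  | cv i hi c t h => exact ⟨(8, ⟨i, by omega⟩, c, t), rfl⟩
  | cvDagger i hi c t h => exact ⟨(9, ⟨i, by omega⟩, c, t), rfl⟩

theorem exists_codes_of_length_le (hn : 0 < n) (s : ℕ) : ∀ K : Circuit n, K.length ≤ s →
    ∃ v : Fin s → Fin 11 × Fin n × Fin n × Fin n,
      circuitOp K = ((List.ofFn v).map opOfCode).reverse.prod := by
  induction s with
  | zero =>
    intro K hK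
    obtain rfl : K = [] := List.eq_nil_of_length_eq_zero (by omega)
    exact ⟨Fin.elim0, by simp [circuitOp]⟩
  | succ s ih =>
    intro K hK
    rcases K with _ | ⟨g, K⟩
    · obtain ⟨v, hv⟩ := ih [] (by simp)
      refine ⟨Fin.cons (10, ⟨0, hn⟩, ⟨0, hn⟩, ⟨0, hn⟩) v, ?_⟩
      rw [List.ofFn_succ]
      simp [hv, opOfCode]
    · obtain ⟨v, hv⟩ := ih K (by simpa using hK)
      obtain ⟨γ, hγ⟩ := exists_opOfCode_eq g
      refine ⟨Fin.cons γ v, ?_⟩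
      rw [List.ofFn_succ]
      simp [hv, hγ, circuitOp]

theorem Computes.unique {K L : Circuit n} {f g : Bits n → Bits n} (hf : Computes K f)
    (hg : Computes L g) (h : circuitOp K = circuitOp L) : f = g := by
  funext x
  have h1 : ket (f x) = ket (g x) := by rw [← hf x, ← hg x, h]
  by_contra hne
  have := congrFun h1 (f x)
  simp [ket, hne] at this

/-- An operator determines the function computed, so permutations inject into code sequences of
length `s`, with `11 * n ^ 3` codes: a gate type, an angle or root index, and two wires. -/
theorem factorial_le_of_forall_computes (hn : 0 < n) (s : ℕ)
    (h : ∀ f : Equiv.Perm (Bits n), ∃ K : Circuit n, Computes K f ∧ K.length ≤ s) :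
    (2 ^ n).factorial ≤ (11 * n ^ 3) ^ s := by
  choose K hK hs using h
  choose v hv using fun f => exists_codes_of_length_le hn s (K f) (hs f)
  have hinj : Function.Injective v := fun f g hfg =>
    Equiv.coe_fn_injective ((hK f).unique (hK g) (by rw [hv, hv, hfg]))
  have := Fintype.card_le_of_injective v hinj
  rw [Fintype.card_perm] at this
  have e : 11 * n ^ 3 = 11 * (n * (n * n)) := by ring
  simpa [e] using this

theorem mul_log_sub_le_log_factorial (N : ℕ) :
    N * Real.log N - N ≤ Real.log N.factorial := by
  rcases N.eq_zero_or_pos with rfl | hN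
  · simp
  have hN' : (0 : ℝ) < N := by exact_mod_cast hN
  have h := Real.pow_div_factorial_le_exp (N : ℝ) hN'.le N
  have hf : (0 : ℝ) < N.factorial := by exact_mod_cast N.factorial_pos
  have h1 := Real.log_le_log (by positivity) h
  rw [Real.log_exp, Real.log_div (by positivity) hf.ne', Real.log_pow] at h1
  linarith

theorem exists_lower_bound : ∃ c : ℝ, 0 < c ∧ ∀ n : ℕ, 2 ≤ n → ∃ f : Bits n → Bits n,
    Function.Bijective f ∧ ∀ K : Circuit n, Computes K f →
      c * (2 ^ n * n / Real.log n) ≤ (K.length : ℝ) := by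
  refine ⟨1 / 100, by norm_num, fun n hn => ?_⟩
  by_contra! hcon
  have hl : 0 < Real.log n := Real.log_pos (by exact_mod_cast (by omega : 1 < n))
  have hn2 : (2 : ℝ) ≤ n := by exact_mod_cast hn
  set B : ℝ := 1 / 100 * (2 ^ n * n / Real.log n) with hB
  have hB0 : 0 ≤ B := by positivity
  have h := factorial_le_of_forall_computes (n := n) (by omega) ⌊B⌋₊ fun f => by
    obtain ⟨K, hK, hlt⟩ := hcon f f.bijective
    exact ⟨K, hK, Nat.le_floor hlt.le⟩
  -- Here `11 ≤ 2 ^ 4 ≤ n ^ 4`, which gives the exponent `7`.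
  have hgates : Real.log (11 * (n : ℝ) ^ 3) ≤ 7 * Real.log n := by
    have e : 7 * Real.log n = Real.log ((n : ℝ) ^ 7) := by rw [Real.log_pow]; norm_num
    rw [e]
    refine Real.log_le_log (by positivity) ?_
    calc 11 * (n : ℝ) ^ 3 ≤ 2 ^ 4 * (n : ℝ) ^ 3 := by gcongr; norm_num
      _ ≤ (n : ℝ) ^ 4 * (n : ℝ) ^ 3 := by gcongr
      _ = (n : ℝ) ^ 7 := by ring
  have h1 : Real.log ((2 ^ n).factorial : ℝ) ≤ ⌊B⌋₊ * Real.log (11 * (n : ℝ) ^ 3) := by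
    rw [← Real.log_pow]
    exact Real.log_le_log (by exact_mod_cast (2 ^ n).factorial_pos) (by exact_mod_cast h)
  have h2 := mul_log_sub_le_log_factorial (2 ^ n)
  push_cast at h2
  rw [Real.log_pow] at h2
  have h3 : (⌊B⌋₊ : ℝ) * Real.log (11 * (n : ℝ) ^ 3) ≤ B * (7 * Real.log n) := by
    have : 0 ≤ Real.log (11 * (n : ℝ) ^ 3) := by
      apply Real.log_nonneg
      nlinarith [one_le_pow₀ (n := 3) (by linarith : (1 : ℝ) ≤ n)]
    exact mul_le_mul (Nat.floor_le hB0) hgates this hB0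
  have h4 : B * (7 * Real.log n) = 7 / 100 * (2 ^ n * n) := by
    rw [hB]; field_simp
  have h5 : (7 / 100 * n : ℝ) < n * Real.log 2 - 1 := by
    nlinarith [Real.log_two_gt_d9]
  have h6 : (2 : ℝ) ^ n * (7 / 100 * n) < 2 ^ n * (n * Real.log 2 - 1) := by gcongr
  linarith

end RevCircuit

theorem theorem1 :
    (∃ C : ℝ, 0 < C ∧ ∀ n : ℕ, 2 ≤ n → ∀ f : RevCircuit.Bits n → RevCircuit.Bits n,
      Function.Bijective f →
        ∃ K : RevCircuit.Circuit n, RevCircuit.Computes K f ∧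
          (K.length : ℝ) ≤ C * (2 ^ n * n / Real.log n)) ∧
    (∃ c : ℝ, 0 < c ∧ ∀ n : ℕ, 2 ≤ n → ∃ f : RevCircuit.Bits n → RevCircuit.Bits n,
      Function.Bijective f ∧
        ∀ K : RevCircuit.Circuit n, RevCircuit.Computes K f →
          c * (2 ^ n * n / Real.log n) ≤ (K.length : ℝ)) :=
  ⟨RevCircuit.exists_upper_bound, RevCircuit.exists_lower_bound⟩
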